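/- **Theorem (Neededness).** *Terms.* $\lambda_{\mathsf{sn}}$-terms are $t ::= x \mid \lambda x.t \mid t\,t \mid t[x\backslash t]$, taken up to $\alpha$-equivalence, where the explicit substitution $t[x\backslash u]$ binds $x$ in $t$ and not in $u$; values $v$ are abstractions. The unfolding $t^\star$ is the pure $\lambda$-term defined by $x^\star=x$, $(t\,u)^\star=t^\star u^\star$, $(\lambda x.t)^\star=\lambda x.t^\star$, $(t[x\backslash u])^\star=t^\star\{x\backslash u^\star\}$ (capture-avoiding substitution). *Structures.* For a set $\varphi$ of (frozen) variables, $\mathcal S_\varphi$ is the least family such that: $x\in\mathcal S_\varphi$ if $x\in\varphi$; $t\,u\in\mathcal S_\varphi$ if $t\in\mathcal S_\varphi$; $t[x\backslash u]\in\mathcal S_\varphi$ if $t\in\mathcal S_\varphi$, or if $t\in\mathcal S_{\varphi\cup\{x\}}$ and $u\in\mathcal S_\varphi$. *Reduction.* The relation $t\to^{\varphi,\mu}_\rho t'$, with $\mu\in\{\top,\bot\}$ and $\rho$ one of $\mathsf{dB}$, $\mathsf{lsv}$, $\mathsf{id}_x$, $\mathsf{sub}_{x\backslash v}$, is defined inductively,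 simultaneously with a relation $\mapsto^{\varphi,\mu}_{\mathsf{lsv}}$, by the following rules; bound variables are always chosen fresh for $\varphi$ and for $\rho$. - $t\,u\to^{\varphi,\mu}_\rho t'\,u$ if $t\to^{\varphi,\bot}_\rho t'$; and $t\,u\to^{\varphi,\mu}_\rho t\,u'$ if $t\in\mathcal S_\varphi$ and $u\to^{\varphi,\top}_\rho u'$. - $\lambda x.t\to^{\varphi,\top}_\rho\lambda x.t'$ if $t\to^{\varphi\cup\{x\},\top}_\rho t'$; and $\lambda x.t\to^{\varphi,\bot}_\rho\lambda x.t'$ if $t\to^{\varphi,\bot}_\rho t'$. - $t[x\backslash u]\to^{\varphi,\mu}_\rho t'[x\backslash u]$ if $t\to^{\varphi,\mu}_\rho t'$, or if $t\to^{\varphi\cup\{x\},\mu}_\rho t'$ and $u\in\mathcal S_\varphi$. - $t[x\backslash u]\to^{\varphi,\mu}_\rho t[x\backslash u']$ if $t\to^{\varphi,\mu}_{\mathsf{id}_x}t$ and $u\to^{\varphi,\bot}_\rho u'$. - $x\to^{\varphi,\mu}_{\mathsf{id}_x}x$ and $x\to^{\varphi,\mu}_{\mathsf{sub}_{x\backslash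 v}}v$. - $t\to^{\varphi,\mu}_{\mathsf{dB}}t'$ if $t\mapsto_{\mathsf{dB}}t'$, where $\mapsto_{\mathsf{dB}}$ is the relation $(\lambda x.t)[x_1\backslash w_1]\cdots[x_n\backslash w_n]\,u\mapsto_{\mathsf{dB}}t[x\backslash u][x_1\backslash w_1]\cdots[x_n\backslash w_n]$, for $n\ge 0$ and $x_1,\dots,x_n$ not free in $u$. - $t\to^{\varphi,\mu}_{\mathsf{lsv}}t'$ if $t\mapsto^{\varphi,\mu}_{\mathsf{lsv}}t'$, where: $t[x\backslash v]\mapsto^{\varphi,\mu}_{\mathsf{lsv}}t'[x\backslash v]$ if $t\to^{\varphi,\mu}_{\mathsf{sub}_{x\backslash v}}t'$ and $v$ is a value; $t[x\backslash u[y\backslash w]]\mapsto^{\varphi,\mu}_{\mathsf{lsv}}t'[y\backslash w]$ if $t[x\backslash u]\mapsto^{\varphi,\mu}_{\mathsf{lsv}}t'$, or if $t[x\backslash u]\mapsto^{\varphi\cup\{y\},\mu}_{\mathsf{lsv}}t'$ and $w\in\mathcal S_\varphi$. A derivation of a $\mathsf{dB}$-step $t\to^{\varphi,\mu}_{\mathsf{dB}}t'$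 determines the position $p$ in $t$ of the subterm $r$ that is reduced, $r=(\lambda x.s)[x_1\backslash w_1]\cdots[x_n\backslash w_n]\,u$. *Occurrences.* The occurrences in $t^\star$ of the corresponding $\beta$-redex are the copies of $r$ that unfolding creates. Their positions form the set $\mathrm{occ}(t,p)$, where $\mathrm{occ}(t,\varepsilon)=\{\varepsilon\}$, $\mathrm{occ}$ commutes with abstraction and with the two sides of an application, $\mathrm{occ}(t[x\backslash u],p)=\mathrm{occ}(t,p')$ if $p$ is the position $p'$ of $t$, and, if $p$ is the position $p'$ of $u$, $\mathrm{occ}(t[x\backslash u],p)$ is the set of all $oq$ with $o$ the position of a free occurrence of $x$ in $t^\star$ and $q\in\mathrm{occ}(u,p')$. *Neededness.* A $\beta$-redex occurrence in a pure $\lambda$-term $M$ is *needed* if every finite $\beta$-reduction sequence from $M$ to a $\beta$-normal form contracts, at some step, that redex or one of its residuals. *Statement.* Let $t$ be a $\lambda_{\mathsf{sn}}$-term such that $t^\star$ is weakly normalizing for $\beta$-reduction. Then for every set $\varphi$ of variables, every $\mu\in\{\top,\bot\}$ and every $\mathsf{dB}$-step $t\to^{\varphi,\mu}_{\mathsf{dB}}t'$,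 reducing the subterm of $t$ at position $p$, there is a position $q\in\mathrm{occ}(t,p)$ in $t^\star$ that is the position of a $\beta$-redex of $t^\star$, and this redex is needed in $t^\star$. -/

import Mathlib

namespace LambdaSN

/-! ### Pure lambda-terms (de Bruijn indices) -/

/-- Pure lambda-terms, up to alpha-equivalence. -/
inductive Lam : Type
  | var : ℕ → Lam
  | app : Lam → Lam → Lam
  | lam : Lam → Lam

/-- Extend a renaming under one binder. -/
def liftRen (f : ℕ → ℕ) : ℕ → ℕ
  | 0 => 0
  | n + 1 => f n + 1

namespace Lam

/-- Renaming of free variables. -/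
def rename : (ℕ → ℕ) → Lam → Lam
  | f, var n => var (f n)
  | f, app M N => app (M.rename f) (N.rename f)
  | f, lam M => lam (M.rename (liftRen f))

/-- Extend a simultaneous substitution under one binder. -/
def liftSub (s : ℕ → Lam) : ℕ → Lam
  | 0 => var 0
  | n + 1 => (s n).rename Nat.succ

/-- Simultaneous capture-avoiding substitution. -/
def subst : (ℕ → Lam) → Lam → Lam
  | s, var n => s n
  | s, app M N => app (M.subst s) (N.subst s)
  | s, lam M => lam (M.subst (liftSub s))

/-- `M.inst N` replaces the variable `0` of `M` by `N` (and decrements the other variables). -/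
def inst (M N : Lam) : Lam :=
  M.subst (fun n => match n with
    | 0 => N
    | k + 1 => var k)

end Lam

/-! ### Positions, beta-reduction, residuals, neededness -/

/-- Directions in a term: `fst` is the left part of an application or of an explicit substitution,
or the body of an abstraction; `snd` is the right part of an application or of an explicit
substitution. -/
inductive Dir : Type
  | fst
  | snd

/-- Positions in terms; the empty list is the root. -/
abbrev Pos : Type := List Dir

/-- `BetaAt M p N`: `M` reduces to `N` by contracting the beta-redex at position `p`. -/
inductive BetaAt : Lam → Pos → Lam → Prop
  | root (M N : Lam) : BetaAt (.app (.lam M) N) [] (M.inst N)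
  | appLeft {M M' : Lam} {p : Pos} (N : Lam) :
      BetaAt M p M' → BetaAt (.app M N) (.fst :: p) (.app M' N)
  | appRight {N N' : Lam} {p : Pos} (M : Lam) :
      BetaAt N p N' → BetaAt (.app M N) (.snd :: p) (.app M N')
  | lam {M M' : Lam} {p : Pos} :
      BetaAt M p M' → BetaAt (.lam M) (.fst :: p) (.lam M')

/-- The position `p` of `M` is the position of a beta-redex. -/
def RedexAt (M : Lam) (p : Pos) : Prop := ∃ N, BetaAt M p N

/-- Beta-normal forms. -/
def Normal (M : Lam) : Prop := ∀ p, ¬ RedexAt M p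

/-- Positions of the free occurrences of the variable `n`. -/
def varOcc : Lam → ℕ → Set Pos
  | .var m, n => {p | m = n ∧ p = []}
  | .app M N, n => List.cons Dir.fst '' varOcc M n ∪ List.cons Dir.snd '' varOcc N n
  | .lam M, n => List.cons Dir.fst '' varOcc M (n + 1)

/-- `Residual M p q q'`: after contraction of the redex at position `p` of `M`, the position `q'` of
the result is a residual of the redex that was at position `q` of `M`. There is no residual
when `q = p`. -/
inductive Residual : Lam → Pos → Pos → Pos → Prop
  | body (M N : Lam) (r : Pos) :
      Residual (.app (.lam M) N) [] (.fst :: .fst :: r) r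
  | arg {M : Lam} (N : Lam) {o : Pos} (r : Pos) :
      o ∈ varOcc M 0 → Residual (.app (.lam M) N) [] (.snd :: r) (o ++ r)
  | above (M : Lam) {p : Pos} : p ≠ [] → Residual M p [] []
  | appLeft {M : Lam} (N : Lam) {p q q' : Pos} :
      Residual M p q q' → Residual (.app M N) (.fst :: p) (.fst :: q) (.fst :: q')
  | appRight (M : Lam) {N : Lam} {p q q' : Pos} :
      Residual N p q q' → Residual (.app M N) (.snd :: p) (.snd :: q) (.snd :: q')
  | lam {M : Lam} {p q q' : Pos} :
      Residual M p q q' → Residual (.lam M) (.fst :: p) (.fst :: q) (.fst :: q')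
  | disjointLeft (M N : Lam) (p q : Pos) :
      Residual (.app M N) (.fst :: p) (.snd :: q) (.snd :: q)
  | disjointRight (M N : Lam) (p q : Pos) :
      Residual (.app M N) (.snd :: p) (.fst :: q) (.fst :: q)

/-- Finite beta-reduction sequences. -/
inductive BetaSeq : Lam → Lam → Type
  | nil (M : Lam) : BetaSeq M M
  | cons {M M' N : Lam} (p : Pos) (h : BetaAt M p M') (s : BetaSeq M' N) : BetaSeq M N

/-- The sequence contracts, at some step, a redex of the set `S` of redex positions of its
source or a residual of such a redex. -/
def BetaSeq.Contracts : {M N : Lam} → BetaSeq M N → Set Pos → Prop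
  | _, _, .nil _, _ => False
  | M, _, .cons p _ s, S => p ∈ S ∨ s.Contracts {q' | ∃ q ∈ S, Residual M p q q'}

/-- Weak normalization for beta-reduction. -/
def WeaklyNormalizing (M : Lam) : Prop := ∃ N, Nonempty (BetaSeq M N) ∧ Normal N

/-- The redex at position `q` of `M` is needed: it or one of its residuals is contracted in every
beta-reduction sequence from `M` to normal form. -/
def Needed (M : Lam) (q : Pos) : Prop :=
  RedexAt M q ∧ ∀ N, Normal N → ∀ s : BetaSeq M N, s.Contracts {q}

/-! ### Terms with explicit substitutions -/

/-- Terms with explicit substitutions. `es t u` is the term `t[x\u]`; it binds the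
variable `0` of `t` and no variable of `u`. -/
inductive Term : Type
  | var : ℕ → Term
  | app : Term → Term → Term
  | lam : Term → Term
  | es : Term → Term → Term

namespace Term

/-- Renaming of free variables. -/
def rename : (ℕ → ℕ) → Term → Term
  | f, var n => var (f n)
  | f, app t u => app (t.rename f) (u.rename f)
  | f, lam t => lam (t.rename (liftRen f))
  | f, es t u => es (t.rename (liftRen f)) (u.rename f)

/-- Weakening by one fresh variable. -/
def shift (t : Term) : Term := t.rename Nat.succ

/-- Unfolding: apply all the explicit substitutions. -/
def unfold : Term → Lam
  | var n => .var n
  | app t u => .app t.unfold u.unfold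
  | lam t => .lam t.unfold
  | es t u => t.unfold.inst u.unfold

/-- `t.copies p` is the set of the positions in `t.unfold` of the occurrences (the copies made by
unfolding, with substitutions applied inside) of the subterm of `t` at position `p`. -/
def copies : Term → Pos → Set Pos
  | _, [] => {[]}
  | app t _, .fst :: p => List.cons Dir.fst '' t.copies p
  | app _ u, .snd :: p => List.cons Dir.snd '' u.copies p
  | lam t, .fst :: p => List.cons Dir.fst '' t.copies p
  | es t _, .fst :: p => t.copies p
  | es t u, .snd :: p => {r | ∃ o ∈ varOcc t.unfold 0, ∃ q ∈ u.copies p, r = o ++ q}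
  | _, _ => ∅

end Term

/-! ### The strong call-by-need calculus -/

/-- The set `φ` of variables seen from under a binder whose variable is not frozen. -/
def under (φ : Set ℕ) : Set ℕ := Nat.succ '' φ

/-- The set `φ` seen from under a binder, together with the bound variable. -/
def underFrozen (φ : Set ℕ) : Set ℕ := insert 0 (Nat.succ '' φ)

/-- Structures under the set `φ` of frozen variables. -/
inductive Struct : Set ℕ → Term → Prop
  | var {φ : Set ℕ} {x : ℕ} : x ∈ φ → Struct φ (.var x)
  | app {φ : Set ℕ} {t : Term} (u : Term) : Struct φ t → Struct φ (.app t u)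
  | es {φ : Set ℕ} {t : Term} (u : Term) : Struct (under φ) t → Struct φ (.es t u)
  | esStruct {φ : Set ℕ} {t u : Term} :
      Struct (underFrozen φ) t → Struct φ u → Struct φ (.es t u)

/-- Names of the reduction rules. -/
inductive Rule : Type
  | dB
  | lsv
  | id (x : ℕ)
  | sub (x : ℕ) (v : Term)

/-- A rule seen from under a binder (the bound variable being fresh for the rule). -/
def Rule.shift : Rule → Rule
  | .dB => .dB
  | .lsv => .lsv
  | .id x => .id (x + 1)
  | .sub x v => .sub (x + 1) v.shift

/-- Values are abstractions. -/
inductive IsValue : Term → Prop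
  | lam (t : Term) : IsValue (.lam t)

/-- The root rule `dB` (beta at a distance). -/
inductive RootDB : Term → Term → Prop
  | base (t u : Term) : RootDB (.app (.lam t) u) (.es t u)
  | sigma {t u z : Term} (w : Term) :
      RootDB (.app t u.shift) z → RootDB (.app (.es t w) u) (.es z w)

mutual

/-- `Step ρ φ μ t p t'`: the term `t` reduces to `t'` by rule `ρ`, in a context where the variables
of `φ` are frozen and that is top-level-like when `μ = true` (`μ = false` stands for `⊥`).
The position `p`, which is only recorded, is that of the subterm of `t` that is reduced. -/
inductive Step : Rule → Set ℕ → Bool → Term → Pos → Term → Prop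
  | appLeft {ρ : Rule} {φ : Set ℕ} {μ : Bool} {t t' : Term} {p : Pos} (u : Term) :
      Step ρ φ false t p t' → Step ρ φ μ (.app t u) (.fst :: p) (.app t' u)
  | appRight {ρ : Rule} {φ : Set ℕ} {μ : Bool} {t u u' : Term} {p : Pos} :
      Struct φ t → Step ρ φ true u p u' → Step ρ φ μ (.app t u) (.snd :: p) (.app t u')
  | absTop {ρ : Rule} {φ : Set ℕ} {t t' : Term} {p : Pos} :
      Step ρ.shift (underFrozen φ) true t p t' →
      Step ρ φ true (.lam t) (.fst :: p) (.lam t')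
  | absBot {ρ : Rule} {φ : Set ℕ} {t t' : Term} {p : Pos} :
      Step ρ.shift (under φ) false t p t' →
      Step ρ φ false (.lam t) (.fst :: p) (.lam t')
  | esLeft {ρ : Rule} {φ : Set ℕ} {μ : Bool} {t t' : Term} {p : Pos} (u : Term) :
      Step ρ.shift (under φ) μ t p t' →
      Step ρ φ μ (.es t u) (.fst :: p) (.es t' u)
  | esLeftStruct {ρ : Rule} {φ : Set ℕ} {μ : Bool} {t t' u : Term} {p : Pos} :
      Step ρ.shift (underFrozen φ) μ t p t' → Struct φ u →
      Step ρ φ μ (.es t u) (.fst :: p) (.es t' u)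
  | esRight {ρ : Rule} {φ : Set ℕ} {μ : Bool} {t u u' : Term} {o p : Pos} :
      Step (.id 0) (under φ) μ t o t → Step ρ φ false u p u' →
      Step ρ φ μ (.es t u) (.snd :: p) (.es t u')
  | id (φ : Set ℕ) (μ : Bool) (x : ℕ) : Step (.id x) φ μ (.var x) [] (.var x)
  | sub (φ : Set ℕ) (μ : Bool) (x : ℕ) (v : Term) : Step (.sub x v) φ μ (.var x) [] v
  | dB {φ : Set ℕ} {μ : Bool} {t t' : Term} : RootDB t t' → Step .dB φ μ t [] t'
  | lsv {φ : Set ℕ} {μ : Bool} {t t' : Term} : RootLsv φ μ t t' → Step .lsv φ μ t [] t'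

/-- The root rule `lsv` (linear substitution of a value). -/
inductive RootLsv : Set ℕ → Bool → Term → Term → Prop
  | base {φ : Set ℕ} {μ : Bool} {t t' v : Term} {o : Pos} :
      Step (.sub 0 v.shift) (under φ) μ t o t' → IsValue v →
      RootLsv φ μ (.es t v) (.es t' v)
  | sigma {φ : Set ℕ} {μ : Bool} {t u t' : Term} (w : Term) :
      RootLsv (under φ) μ (.es (t.rename (liftRen Nat.succ)) u) t' →
      RootLsv φ μ (.es t (.es u w)) (.es t' w)
  | sigmaStruct {φ : Set ℕ} {μ : Bool} {t u t' w : Term} :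
      RootLsv (underFrozen φ) μ (.es (t.rename (liftRen Nat.succ)) u) t' → Struct φ w →
      RootLsv φ μ (.es t (.es u w)) (.es t' w)

end

end LambdaSN

/-!
Call a position of a pure term *essential* (`Essential φ μ M q`) when it is reached from the root
by going into the function part of an application, into the argument of an application whose
function part is a neutral term headed by a frozen variable, or under an abstraction; an
abstraction that may still be applied (`μ = false`) does not freeze its variable, any other one
does. So an essential position is never inside the argument of a beta-redex, and if
a redex is there, no contraction of another redex can erase or duplicate it.

The theorem follows from two facts.

* An essential redex is needed (`Essential.needed`). Contracting any other redex leaves a residual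
  of it that is an essential redex of the result (`Essential.exists_residual`). The only case in
  which its position changes is that of a redex `(λ x, M) N` above it: it is then in `M`, and since
  `x` is not frozen there, it remains essential in `M{x\N}`. As a term with an essential redex is
  not normal, a reduction sequence to normal form must contract one of these residuals.
* A step of the strong call-by-need calculus acts on a subterm one of whose copies in the unfolding
  is at an essential position (`Step.exists_essential`). For a reduction inside `u` in
  `t[x\u]`, the side condition provides an essential free occurrence of `x` in the unfolding of
  `t`; the copy of `u` substituted there is essential, and so are its own essential positions
  (`Essential.subst_append`). This is why the induction has to treat the rule `id` together with
  `dB`.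
-/

namespace LambdaSN

/-! ### Neutral terms with a frozen head variable -/

/-- Terms `x M₁ ⋯ Mₙ` whose head variable `x` belongs to `φ`: the pure terms among the structures
under `φ`. -/
inductive Neutral : Set ℕ → Lam → Prop
  | var {φ : Set ℕ} {x : ℕ} : x ∈ φ → Neutral φ (.var x)
  | app {φ : Set ℕ} {M : Lam} (N : Lam) : Neutral φ M → Neutral φ (.app M N)

theorem under_mono {φ ψ : Set ℕ} (h : φ ⊆ ψ) : under φ ⊆ under ψ :=
  Set.image_mono h

theorem underFrozen_mono {φ ψ : Set ℕ} (h : φ ⊆ ψ) : underFrozen φ ⊆ underFrozen ψ :=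
  Set.insert_subset_insert (Set.image_mono h)

theorem under_subset_underFrozen {φ ψ : Set ℕ} (h : φ ⊆ ψ) : under φ ⊆ underFrozen ψ :=
  (under_mono h).trans (Set.subset_insert _ _)

theorem mapsTo_liftRen_under {f : ℕ → ℕ} {φ ψ : Set ℕ} (h : Set.MapsTo f φ ψ) :
    Set.MapsTo (liftRen f) (under φ) (under ψ) := by
  rintro _ ⟨x, hx, rfl⟩
  exact ⟨f x, h hx, rfl⟩

theorem mapsTo_liftRen_underFrozen {f : ℕ → ℕ} {φ ψ : Set ℕ} (h : Set.MapsTo f φ ψ) :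
    Set.MapsTo (liftRen f) (underFrozen φ) (underFrozen ψ) := by
  rintro _ (rfl | ⟨x, hx, rfl⟩)
  · exact Or.inl rfl
  · exact Or.inr ⟨f x, h hx, rfl⟩

theorem mapsTo_succ_under (φ : Set ℕ) : Set.MapsTo Nat.succ φ (under φ) :=
  Set.mapsTo_image _ _

theorem mapsTo_succ_underFrozen (φ : Set ℕ) : Set.MapsTo Nat.succ φ (underFrozen φ) :=
  fun _ hx => Or.inr ⟨_, hx, rfl⟩

namespace Neutral

theorem mono {φ ψ : Set ℕ} {M : Lam} (h : Neutral φ M) (hφ : φ ⊆ ψ) : Neutral ψ M := by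
  induction h with
  | var hx => exact .var (hφ hx)
  | app N _ ih => exact .app N ih

theorem rename {φ ψ : Set ℕ} {M : Lam} (h : Neutral φ M) {f : ℕ → ℕ} (hf : Set.MapsTo f φ ψ) :
    Neutral ψ (M.rename f) := by
  induction h with
  | var hx => exact .var (hf hx)
  | app N _ ih => exact .app _ ih

theorem subst {φ ψ : Set ℕ} {M : Lam} (h : Neutral φ M) {s : ℕ → Lam}
    (hs : ∀ x ∈ φ, Neutral ψ (s x)) : Neutral ψ (M.subst s) := by
  induction h with
  | var hx => exact hs _ hx
  | app N _ ih => exact .app _ ih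

theorem liftSub_under {φ ψ : Set ℕ} {s : ℕ → Lam} (hs : ∀ x ∈ φ, Neutral ψ (s x)) :
    ∀ x ∈ under φ, Neutral (under ψ) (Lam.liftSub s x) := by
  rintro _ ⟨x, hx, rfl⟩
  exact (hs x hx).rename (mapsTo_succ_under ψ)

theorem liftSub_underFrozen {φ ψ : Set ℕ} {s : ℕ → Lam} (hs : ∀ x ∈ φ, Neutral ψ (s x)) :
    ∀ x ∈ underFrozen φ, Neutral (underFrozen ψ) (Lam.liftSub s x) := by
  rintro _ (rfl | ⟨x, hx, rfl⟩)
  · exact .var (Or.inl rfl)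
  · exact (hs x hx).rename (mapsTo_succ_underFrozen ψ)

theorem betaAt {φ : Set ℕ} {M M' : Lam} {p : Pos} (h : Neutral φ M) (hb : BetaAt M p M') :
    Neutral φ M' := by
  induction h generalizing p M' with
  | var hx => cases hb
  | app N h ih =>
    cases hb with
    | root => cases h
    | appLeft _ hb => exact .app _ (ih hb)
    | appRight _ hb => exact .app _ h

end Neutral

/-- The substitution performed by `Lam.inst`. -/
def instSub (N : Lam) : ℕ → Lam
  | 0 => N
  | k + 1 => .var k

theorem inst_eq_subst (M N : Lam) : M.inst N = M.subst (instSub N) :=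
  rfl

theorem neutral_instSub_under (φ : Set ℕ) (N : Lam) :
    ∀ x ∈ under φ, Neutral φ (instSub N x) := by
  rintro _ ⟨x, hx, rfl⟩
  exact .var hx

theorem neutral_instSub_underFrozen {φ : Set ℕ} {N : Lam} (hN : Neutral φ N) :
    ∀ x ∈ underFrozen φ, Neutral φ (instSub N x) := by
  rintro _ (rfl | ⟨x, hx, rfl⟩)
  · exact hN
  · exact .var hx

/-! ### Redexes and variable occurrences under substitution -/

theorem redexAt_root (M N : Lam) : RedexAt (.app (.lam M) N) [] :=
  ⟨_, .root M N⟩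

theorem RedexAt.appLeft {M : Lam} {p : Pos} (h : RedexAt M p) (N : Lam) :
    RedexAt (.app M N) (.fst :: p) :=
  let ⟨_, h⟩ := h; ⟨_, .appLeft N h⟩

theorem RedexAt.appRight {N : Lam} {p : Pos} (h : RedexAt N p) (M : Lam) :
    RedexAt (.app M N) (.snd :: p) :=
  let ⟨_, h⟩ := h; ⟨_, .appRight M h⟩

theorem RedexAt.lam {M : Lam} {p : Pos} (h : RedexAt M p) : RedexAt (.lam M) (.fst :: p) :=
  let ⟨_, h⟩ := h; ⟨_, .lam h⟩

theorem RedexAt.rename {M : Lam} {p : Pos} (h : RedexAt M p) (f : ℕ → ℕ) :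
    RedexAt (M.rename f) p := by
  obtain ⟨M', h⟩ := h
  induction h generalizing f with
  | root M N => exact redexAt_root _ _
  | appLeft N _ ih => exact (ih f).appLeft _
  | appRight M _ ih => exact (ih f).appRight _
  | lam _ ih => exact (ih (liftRen f)).lam

theorem RedexAt.subst {M : Lam} {p : Pos} (h : RedexAt M p) (s : ℕ → Lam) :
    RedexAt (M.subst s) p := by
  obtain ⟨M', h⟩ := h
  induction h generalizing s with
  | root M N => exact redexAt_root _ _
  | appLeft N _ ih => exact (ih s).appLeft _
  | appRight M _ ih => exact (ih s).appRight _
  | lam _ ih => exact (ih (Lam.liftSub s)).lam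

theorem RedexAt.subst_append {M : Lam} {n : ℕ} {o q : Pos} {s : ℕ → Lam}
    (ho : o ∈ varOcc M n) (hq : RedexAt (s n) q) : RedexAt (M.subst s) (o ++ q) := by
  induction M generalizing n o s with
  | var m =>
    obtain ⟨rfl, rfl⟩ := ho
    exact hq
  | app M N ihM ihN =>
    rcases ho with ⟨o, ho, rfl⟩ | ⟨o, ho, rfl⟩
    · exact (ihM ho hq).appLeft _
    · exact (ihN ho hq).appRight _
  | lam M ih =>
    obtain ⟨o, ho, rfl⟩ := ho
    exact (ih ho (s := Lam.liftSub s) (hq.rename Nat.succ)).lam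

theorem mem_varOcc_rename {M : Lam} {n : ℕ} {o : Pos} (f : ℕ → ℕ) (ho : o ∈ varOcc M n) :
    o ∈ varOcc (M.rename f) (f n) := by
  induction M generalizing n o f with
  | var m =>
    obtain ⟨rfl, rfl⟩ := ho
    exact ⟨rfl, rfl⟩
  | app M N ihM ihN =>
    rcases ho with ⟨o, ho, rfl⟩ | ⟨o, ho, rfl⟩
    · exact Or.inl ⟨o, ihM f ho, rfl⟩
    · exact Or.inr ⟨o, ihN f ho, rfl⟩
  | lam M ih =>
    obtain ⟨o, ho, rfl⟩ := ho
    exact ⟨o, ih (liftRen f) ho, rfl⟩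

theorem mem_varOcc_subst_append {M : Lam} {n m : ℕ} {o q : Pos} {s : ℕ → Lam}
    (ho : o ∈ varOcc M n) (hq : q ∈ varOcc (s n) m) : o ++ q ∈ varOcc (M.subst s) m := by
  induction M generalizing n m o s with
  | var k =>
    obtain ⟨rfl, rfl⟩ := ho
    exact hq
  | app M N ihM ihN =>
    rcases ho with ⟨o, ho, rfl⟩ | ⟨o, ho, rfl⟩
    · exact Or.inl ⟨_, ihM ho hq, rfl⟩
    · exact Or.inr ⟨_, ihN ho hq, rfl⟩
  | lam M ih =>
    obtain ⟨o, ho, rfl⟩ := ho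
    exact ⟨_, ih ho (s := Lam.liftSub s) (mem_varOcc_rename Nat.succ hq), rfl⟩

/-! ### Essential positions -/

/-- `Essential φ μ M q`: the position `q` of `M` is reached by a path that an evaluation of `M` to
normal form has to follow when the variables of `φ` are frozen. If `μ = false`, then `M` may be
applied to an argument, so that the variable of a leading abstraction is not frozen. -/
inductive Essential : Set ℕ → Bool → Lam → Pos → Prop
  | root (φ : Set ℕ) (μ : Bool) (M : Lam) : Essential φ μ M []
  | appLeft {φ : Set ℕ} {μ : Bool} {M : Lam} {q : Pos} (N : Lam) :
      Essential φ false M q → Essential φ μ (.app M N) (.fst :: q)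
  | appRight {φ : Set ℕ} {μ : Bool} {M N : Lam} {q : Pos} :
      Neutral φ M → Essential φ true N q → Essential φ μ (.app M N) (.snd :: q)
  | lamTop {φ : Set ℕ} {M : Lam} {q : Pos} :
      Essential (underFrozen φ) true M q → Essential φ true (.lam M) (.fst :: q)
  | lamBot {φ : Set ℕ} {M : Lam} {q : Pos} :
      Essential (under φ) false M q → Essential φ false (.lam M) (.fst :: q)

namespace Essential

theorem mono {φ ψ : Set ℕ} {μ : Bool} {M : Lam} {q : Pos} (h : Essential φ μ M q)
    (hφ : φ ⊆ ψ) : Essential ψ μ M q := by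
  induction h generalizing ψ with
  | root => exact .root _ _ _
  | appLeft N _ ih => exact .appLeft N (ih hφ)
  | appRight hM _ ih => exact .appRight (hM.mono hφ) (ih hφ)
  | lamTop _ ih => exact .lamTop (ih (underFrozen_mono hφ))
  | lamBot _ ih => exact .lamBot (ih (under_mono hφ))

theorem true_of_false {φ : Set ℕ} {M : Lam} {q : Pos} (h : Essential φ false M q) :
    Essential φ true M q := by
  induction M generalizing φ q with
  | var m => cases h; exact .root _ _ _
  | app M N _ _ =>
    cases h with
    | root => exact .root _ _ _
    | appLeft _ h => exact .appLeft _ h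
    | appRight hM h => exact .appRight hM h
  | lam M ih =>
    cases h with
    | root => exact .root _ _ _
    | lamBot h => exact .lamTop ((ih h).mono (under_subset_underFrozen subset_rfl))

theorem of_false {φ : Set ℕ} {M : Lam} {q : Pos} (h : Essential φ false M q) (μ : Bool) :
    Essential φ μ M q := by
  cases μ
  · exact h
  · exact h.true_of_false

theorem rename {φ ψ : Set ℕ} {μ : Bool} {M : Lam} {q : Pos} (h : Essential φ μ M q)
    {f : ℕ → ℕ} (hf : Set.MapsTo f φ ψ) : Essential ψ μ (M.rename f) q := by
  induction h generalizing ψ f with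
  | root => exact .root _ _ _
  | appLeft N _ ih => exact .appLeft _ (ih hf)
  | appRight hM _ ih => exact .appRight (hM.rename hf) (ih hf)
  | lamTop _ ih => exact .lamTop (ih (mapsTo_liftRen_underFrozen hf))
  | lamBot _ ih => exact .lamBot (ih (mapsTo_liftRen_under hf))

/-- Only the frozen variables matter: the others may be substituted by arbitrary terms. -/
theorem subst {φ ψ : Set ℕ} {μ : Bool} {M : Lam} {q : Pos} (h : Essential φ μ M q)
    {s : ℕ → Lam} (hs : ∀ x ∈ φ, Neutral ψ (s x)) : Essential ψ μ (M.subst s) q := by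
  induction h generalizing ψ s with
  | root => exact .root _ _ _
  | appLeft N _ ih => exact .appLeft _ (ih hs)
  | appRight hM _ ih => exact .appRight (hM.subst hs) (ih hs)
  | lamTop _ ih => exact .lamTop (ih (Neutral.liftSub_underFrozen hs))
  | lamBot _ ih => exact .lamBot (ih (Neutral.liftSub_under hs))

/-- An essential occurrence of a variable may be applied to arguments, whence the `false` in the
assumption on the substituted term. -/
theorem subst_append {φ ψ : Set ℕ} {μ : Bool} {M : Lam} {n : ℕ} {o q : Pos}
    (h : Essential φ μ M o) (ho : o ∈ varOcc M n) {s : ℕ → Lam}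
    (hs : ∀ x ∈ φ, Neutral ψ (s x)) (hq : Essential ψ false (s n) q) :
    Essential ψ μ (M.subst s) (o ++ q) := by
  induction h generalizing n ψ s with
  | root φ μ M =>
    cases M with
    | var m =>
      obtain ⟨rfl, -⟩ := ho
      exact hq.of_false μ
    | app M N => simp [varOcc] at ho
    | lam M => simp [varOcc] at ho
  | appLeft N _ ih =>
    exact .appLeft _ (ih (by simpa [varOcc] using ho) hs hq)
  | appRight hM _ ih =>
    exact .appRight (hM.subst hs) (ih (by simpa [varOcc] using ho) hs hq)
  | lamTop _ ih =>
    exact .lamTop (ih (n := n + 1) (by simpa [varOcc] using ho) (Neutral.liftSub_underFrozen hs)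
      (hq.rename (mapsTo_succ_underFrozen ψ)))
  | lamBot _ ih =>
    exact .lamBot (ih (n := n + 1) (by simpa [varOcc] using ho) (Neutral.liftSub_under hs)
      (hq.rename (mapsTo_succ_under ψ)))

/-! ### Essential redexes are needed -/

theorem exists_residual {φ : Set ℕ} {μ : Bool} {M M' : Lam} {p q : Pos}
    (h : Essential φ μ M q) (hq : RedexAt M q) (hb : BetaAt M p M') (hpq : p ≠ q) :
    ∃ q', Residual M p q q' ∧ Essential φ μ M' q' ∧ RedexAt M' q' := by
  induction h generalizing p M' with
  | root φ μ M =>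
    refine ⟨[], .above M hpq, .root _ _ _, ?_⟩
    obtain ⟨_, hq⟩ := hq
    cases hq with
    | root A B =>
      cases hb with
      | root => exact absurd rfl hpq
      | appLeft _ hb =>
        cases hb with
        | lam hb => exact redexAt_root _ _
      | appRight _ hb => exact redexAt_root _ _
  | appLeft N h ih =>
    obtain ⟨_, hq⟩ := hq
    cases hq with
    | appLeft _ hq =>
      cases hb with
      | root A _ =>
        -- The redex `q` is below the contracted one, in the body of its abstraction.
        cases hq with
        | lam hq =>
          cases h with
          | lamBot h =>
            refine ⟨_, .body _ _ _, ?_, ?_⟩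
            · rw [inst_eq_subst]
              exact (h.subst (neutral_instSub_under _ N)).of_false _
            · rw [inst_eq_subst]
              exact RedexAt.subst ⟨_, hq⟩ _
      | appLeft _ hb =>
        obtain ⟨q', hr, he, hq'⟩ := ih ⟨_, hq⟩ hb (fun e => hpq (by rw [e]))
        exact ⟨_, .appLeft N hr, .appLeft N he, hq'.appLeft N⟩
      | appRight _ hb =>
        exact ⟨_, .disjointRight _ _ _ _, .appLeft _ h, RedexAt.appLeft ⟨_, hq⟩ _⟩
  | appRight hM h ih =>
    obtain ⟨_, hq⟩ := hq
    cases hq with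
    | appRight _ hq =>
      cases hb with
      | root A _ => cases hM
      | appLeft _ hb =>
        exact ⟨_, .disjointLeft _ _ _ _, .appRight (hM.betaAt hb) h, RedexAt.appRight ⟨_, hq⟩ _⟩
      | appRight _ hb =>
        obtain ⟨q', hr, he, hq'⟩ := ih ⟨_, hq⟩ hb (fun e => hpq (by rw [e]))
        exact ⟨_, .appRight _ hr, .appRight hM he, hq'.appRight _⟩
  | lamTop h ih =>
    obtain ⟨_, hq⟩ := hq
    cases hq with
    | lam hq =>
      cases hb with
      | lam hb =>
        obtain ⟨q', hr, he, hq'⟩ := ih ⟨_, hq⟩ hb (fun e => hpq (by rw [e]))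
        exact ⟨_, .lam hr, .lamTop he, hq'.lam⟩
  | lamBot h ih =>
    obtain ⟨_, hq⟩ := hq
    cases hq with
    | lam hq =>
      cases hb with
      | lam hb =>
        obtain ⟨q', hr, he, hq'⟩ := ih ⟨_, hq⟩ hb (fun e => hpq (by rw [e]))
        exact ⟨_, .lam hr, .lamBot he, hq'.lam⟩

theorem contracts {φ : Set ℕ} {μ : Bool} {M N : Lam} (s : BetaSeq M N) (hN : Normal N)
    {q : Pos} {S : Set Pos} (hS : q ∈ S) (h : Essential φ μ M q) (hq : RedexAt M q) :
    s.Contracts S := by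
  induction s generalizing q S with
  | nil M => exact hN q hq
  | cons p hb s ih =>
    by_cases hpq : p = q
    · exact Or.inl (hpq ▸ hS)
    · obtain ⟨q', hr, he, hq'⟩ := h.exists_residual hq hb hpq
      exact Or.inr (ih hN ⟨q, hS, hr⟩ he hq')

theorem needed {φ : Set ℕ} {μ : Bool} {M : Lam} {q : Pos} (h : Essential φ μ M q)
    (hq : RedexAt M q) : Needed M q :=
  ⟨hq, fun _ hN s => contracts s hN rfl h hq⟩

end Essential

/-! ### Steps with explicit substitutions -/

theorem Struct.neutral_unfold {φ : Set ℕ} {t : Term} (h : Struct φ t) : Neutral φ t.unfold := by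
  induction h with
  | var hx => exact .var hx
  | app u _ ih => exact .app _ ih
  | es u _ ih =>
    rw [Term.unfold, inst_eq_subst]
    exact ih.subst (neutral_instSub_under _ _)
  | esStruct _ _ iht ihu =>
    rw [Term.unfold, inst_eq_subst]
    exact iht.subst (neutral_instSub_underFrozen ihu)

theorem RootDB.unfold_eq_lam {r t' : Term} (h : RootDB r t') :
    ∃ a u A, r = .app a u ∧ a.unfold = .lam A := by
  induction h with
  | base t u => exact ⟨_, _, _, rfl, rfl⟩
  | sigma w _ ih =>
    obtain ⟨a, u, A, e, hA⟩ := ih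
    cases e
    exact ⟨_, _, _, rfl, by rw [Term.unfold, hA]; rfl⟩

theorem RootDB.redexAt_unfold {t t' : Term} (h : RootDB t t') : RedexAt t.unfold [] := by
  obtain ⟨a, u, A, rfl, hA⟩ := h.unfold_eq_lam
  rw [Term.unfold, hA]
  exact redexAt_root _ _

/-- What a step by a given rule has at the copy `q` of its position: a redex for `dB`, an
occurrence of `x` for `id x`. The other two rules play no part in `dB`-steps, and nothing is
asked of them. -/
def Target : Rule → Lam → Pos → Prop
  | .dB, M, q => RedexAt M q
  | .id x, M, q => q ∈ varOcc M x
  | .lsv, _, _ => True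
  | .sub _ _, _, _ => True

namespace Target

theorem appLeft {ρ : Rule} {M : Lam} {q : Pos} (h : Target ρ M q) (N : Lam) :
    Target ρ (.app M N) (.fst :: q) := by
  cases ρ with
  | dB => exact RedexAt.appLeft h N
  | id x => exact Or.inl ⟨q, h, rfl⟩
  | lsv => trivial
  | sub x v => trivial

theorem appRight {ρ : Rule} {N : Lam} {q : Pos} (h : Target ρ N q) (M : Lam) :
    Target ρ (.app M N) (.snd :: q) := by
  cases ρ with
  | dB => exact RedexAt.appRight h M
  | id x => exact Or.inr ⟨q, h, rfl⟩
  | lsv => trivial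
  | sub x v => trivial

theorem lam {ρ : Rule} {M : Lam} {q : Pos} (h : Target ρ.shift M q) :
    Target ρ (.lam M) (.fst :: q) := by
  cases ρ with
  | dB => exact RedexAt.lam h
  | id x => exact ⟨q, h, rfl⟩
  | lsv => trivial
  | sub x v => trivial

theorem instSub {ρ : Rule} {M : Lam} {q : Pos} (h : Target ρ.shift M q) (N : Lam) :
    Target ρ (M.subst (instSub N)) q := by
  cases ρ with
  | dB => exact RedexAt.subst h _
  | id x =>
    have := mem_varOcc_subst_append (s := LambdaSN.instSub N) (m := x) (q := []) h ⟨rfl, rfl⟩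
    rwa [List.append_nil] at this
  | lsv => trivial
  | sub x v => trivial

theorem subst_append {ρ : Rule} {M : Lam} {n : ℕ} {o q : Pos} {s : ℕ → Lam}
    (ho : o ∈ varOcc M n) (hq : Target ρ (s n) q) : Target ρ (M.subst s) (o ++ q) := by
  cases ρ with
  | dB => exact RedexAt.subst_append ho hq
  | id x => exact mem_varOcc_subst_append ho hq
  | lsv => trivial
  | sub x v => trivial

end Target

theorem Term.nil_mem_copies (t : Term) : [] ∈ t.copies [] := by
  cases t <;> simp [Term.copies]

theorem Step.exists_essential {ρ : Rule} {φ : Set ℕ} {μ : Bool} {t t' : Term} {p : Pos}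
    (h : Step ρ φ μ t p t') :
    ∃ q ∈ t.copies p, Essential φ μ t.unfold q ∧ Target ρ t.unfold q := by
  -- `Step` is defined together with `RootLsv`, of which nothing is needed.
  induction h using Step.rec (motive_2 := fun _ _ _ _ _ => True) with
  | appLeft u _ ih =>
    obtain ⟨q, hc, he, ht⟩ := ih
    exact ⟨_, ⟨q, hc, rfl⟩, he.appLeft _, ht.appLeft _⟩
  | appRight hs _ ih =>
    obtain ⟨q, hc, he, ht⟩ := ih
    exact ⟨_, ⟨q, hc, rfl⟩, .appRight hs.neutral_unfold he, ht.appRight _⟩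
  | absTop _ ih =>
    obtain ⟨q, hc, he, ht⟩ := ih
    exact ⟨_, ⟨q, hc, rfl⟩, he.lamTop, ht.lam⟩
  | absBot _ ih =>
    obtain ⟨q, hc, he, ht⟩ := ih
    exact ⟨_, ⟨q, hc, rfl⟩, he.lamBot, ht.lam⟩
  | esLeft u _ ih =>
    obtain ⟨q, hc, he, ht⟩ := ih
    rw [Term.unfold, inst_eq_subst]
    exact ⟨q, hc, he.subst (neutral_instSub_under _ _), ht.instSub _⟩
  | esLeftStruct _ hs ih =>
    obtain ⟨q, hc, he, ht⟩ := ih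
    rw [Term.unfold, inst_eq_subst]
    exact ⟨q, hc, he.subst (neutral_instSub_underFrozen hs.neutral_unfold), ht.instSub _⟩
  | esRight _ _ iht ihu =>
    obtain ⟨o, -, heo, ho⟩ := iht
    obtain ⟨q, hc, he, ht⟩ := ihu
    rw [Term.unfold, inst_eq_subst]
    exact ⟨o ++ q, ⟨o, ho, q, hc, rfl⟩, heo.subst_append ho (neutral_instSub_under _ _) he,
      Target.subst_append ho ht⟩
  | id φ μ x => exact ⟨[], Term.nil_mem_copies _, .root _ _ _, rfl, rfl⟩
  | sub φ μ x v => exact ⟨[], Term.nil_mem_copies _, .root _ _ _, trivial⟩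
  | dB h => exact ⟨[], Term.nil_mem_copies _, .root _ _ _, h.redexAt_unfold⟩
  | lsv _ _ => exact ⟨[], Term.nil_mem_copies _, .root _ _ _, trivial⟩
  | base _ _ _ => trivial
  | sigma _ _ _ => trivial
  | sigmaStruct _ _ _ => trivial

end LambdaSN

theorem mainTheorem2 (t : LambdaSN.Term) (hwn : LambdaSN.WeaklyNormalizing t.unfold)
    (φ : Set ℕ) (μ : Bool) (p : LambdaSN.Pos) (t' : LambdaSN.Term)
    (hstep : LambdaSN.Step LambdaSN.Rule.dB φ μ t p t') :
    ∃ q ∈ t.copies p, LambdaSN.Needed t.unfold q := by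
  obtain ⟨q, hc, he, hq⟩ := hstep.exists_essential
  exact ⟨q, hc, he.needed hq⟩
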